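/- Let $L\ge 2$, $n\ge 1$, $N\ge 0$ be integers and consider an $L\times L$ Fuchsian system $$\frac{dY}{dz}=A(z)Y,\qquad A(z)=\sum_{i=0}^{N+1}\frac{A_i}{z-u_i},$$ with $A_i\in\mathbb C^{L\times L}$ and singularities $S=\{u_0=1,u_1,\dots,u_N,u_{N+1}=0,u_{N+2}=\infty\}$ ($N+3$ distinct points). Assume that $A_{N+1}$ is upper triangular, that $A_{N+2}:=-\sum_{i=0}^{N+1}A_i$ is lower triangular, and that no two of the characteristic exponents $\varepsilon_{0,0},\dots,\varepsilon_{0,L-1}$ at $z=0$ (the eigenvalues of $A_{N+1}$ with multiplicity), and no two of the characteristic exponents $\varepsilon_{\infty,0},\dots,\varepsilon_{\infty,L-1}$ at $z=\infty$ (those of $A_{N+2}$), differ by an integer. Let $Y$ be a (multivalued) solution on $\mathbb P^1\setminus S$ which is normalized, i.e. $$Y=\Psi(z)\,\mathrm{diag}(z^{\varepsilon_{0,j}})_{0\le j\le L-1}\ \text{ near } z=0,\qquad Y=\Phi(w)\,\mathrm{diag}(w^{\varepsilon_{\infty,j}})_{0\le j\le L-1}\,C\ \text{ near } w=1/z=0,$$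 where $\Psi,\Phi$ are convergent power series, $\Psi(0)$ is upper triangular with ones on the diagonal, $\Phi(0)$ is invertible and lower triangular, and $C$ is an invertible constant matrix; here a base point, paths from it to the neighbourhoods of $0$ and $\infty$, and branches of $\log z$ there are fixed. Let $f_0,\dots,f_{L-1}\in\mathbb C[[w]]$ be the entries of the first column of $\Phi(w)$, and suppose that $f_0,\dots,f_{L-1}$ are generic in the sense that for each $0\le i\le L-1$ there are polynomials $Q^{(i)}_j(w)$ ($0\le j\le L-1$) with $\deg Q^{(i)}_j\le n-1+\delta_{ij}$, with $Q^{(i)}_i$ monic of degree $n$, and with $$\sum_{j\le i}Q^{(i)}_jf_j+\sum_{j>i}w\,Q^{(i)}_jf_j=O(w^{nL}).$$ Fix such polynomials, put $\widetilde Q^{(i)}_j=Q^{(i)}_j$ for $j\le i$ and $\widetilde Q^{(i)}_j=wQ^{(i)}_j$ for $j>i$, and let $R(z)$ be the polynomial matrix with entries $R_{ij}(z)=z^n\,\widetilde Q^{(i)}_j(z^{-1})$. Then $Y\mapsto\hat Y=RY$ is a Schlesinger transformation which shifts the characteristic exponents at $z=\infty$ by $(n(L-1),-n,\dots,-n)$.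 That is: 1. There are constant matrices $\hat A_0,\dots,\hat A_{N+1}$, with $\hat A_i$ conjugate to $A_i$ for each $0\le i\le N+1$, such that $\hat Y$ is a solution of the Fuchsian system $d\hat Y/dz=\sum_{i=0}^{N+1}\frac{\hat A_i}{z-u_i}\hat Y$ with the same singularities $S$. This system again satisfies all the assumptions above ($\hat A_{N+1}$ upper triangular, $\hat A_{N+2}:=-\sum_{i=0}^{N+1}\hat A_i$ lower triangular, no integer differences of exponents). Its exponents at $0$ are $\varepsilon_{0,0},\dots,\varepsilon_{0,L-1}$, and its exponents at $\infty$ are $\varepsilon_{\infty,0}+n(L-1),\ \varepsilon_{\infty,1}-n,\dots,\varepsilon_{\infty,L-1}-n$. The solution $\hat Y$ is normalized in the same sense with respect to these exponents, with the same paths and branches and the same connection matrix $C$. 2. The monodromy is unchanged: for every loop $\gamma$ in $\mathbb P^1\setminus S$ at the base point and every matrix $M$, analytic continuation along $\gamma$ turns $Y$ into $YM$ if and only if it turns $\hat Y$ into $\hat YM$. -/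

import Mathlib

/-! ## Type I Hermite–Padé approximation -/

/-- The matrix whose `i`-th row is `(Q₀⁽ⁱ⁾, …, Qᵢ⁽ⁱ⁾, w Qᵢ₊₁⁽ⁱ⁾, …, w Q_{L-1}⁽ⁱ⁾)`. -/
noncomputable def tildeQ {L : ℕ} (Q : Fin L → Fin L → Polynomial ℂ) (i j : Fin L) :
    Polynomial ℂ :=
  if i < j then Polynomial.X * Q i j else Q i j

/-- `Q i j = Q_j⁽ⁱ⁾` are the normalized type I Hermite–Padé approximants of the formal power
series `f₀, …, f_{L-1}`: `deg Q_j⁽ⁱ⁾ ≤ n - 1 + δ_{ij}`, the remainder of the `i`-th row is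
`O(w^{nL})`, and the coefficient of `w ^ n` in `Qᵢ⁽ⁱ⁾` is one. -/
structure IsHermitePade {L : ℕ} (n : ℕ) (f : Fin L → PowerSeries ℂ)
    (Q : Fin L → Fin L → Polynomial ℂ) : Prop where
  degree_lt : ∀ i j, (Q i j).degree < ((n + if i = j then 1 else 0 : ℕ) : WithBot ℕ)
  approx : ∀ i, (PowerSeries.X : PowerSeries ℂ) ^ (n * L) ∣
    ∑ j, (tildeQ Q i j : PowerSeries ℂ) * f j
  normalized : ∀ i, (Q i i).coeff n = 1

/-- The polynomial matrix `R(z)`, with entries `z ^ n * Q̃_j⁽ⁱ⁾(z⁻¹)`. All the `Q̃_j⁽ⁱ⁾` have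
degree at most `n`, so that this is reversal of coefficients, `w ^ k ↦ z ^ (n - k)`. -/
noncomputable def schlesingerMatrix {L : ℕ} (n : ℕ) (Q : Fin L → Fin L → Polynomial ℂ) :
    Matrix (Fin L) (Fin L) (Polynomial ℂ) :=
  Matrix.of fun i j => (tildeQ Q i j).reflect n

/-- The value at `z` of a matrix of polynomials. -/
noncomputable def evalPoly {L : ℕ} (R : Matrix (Fin L) (Fin L) (Polynomial ℂ)) (z : ℂ) :
    Matrix (Fin L) (Fin L) ℂ :=
  R.map (Polynomial.eval z)

/-! ## Fuchsian systems -/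

/-- The coefficient `A(z) = ∑ᵢ Aᵢ / (z - uᵢ)` of the Fuchsian system `dY/dz = A(z) Y`. -/
noncomputable def fuchsCoeff {L N : ℕ} (u : Fin (N + 2) → ℂ)
    (A : Fin (N + 2) → Matrix (Fin L) (Fin L) ℂ) (z : ℂ) : Matrix (Fin L) (Fin L) ℂ :=
  ∑ i, (z - u i)⁻¹ • A i

/-- The residue matrix at infinity, `A_{N+2} = -∑ᵢ Aᵢ`. -/
def residueInfty {L N : ℕ} (A : Fin (N + 2) → Matrix (Fin L) (Fin L) ℂ) :
    Matrix (Fin L) (Fin L) ℂ :=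
  -∑ i, A i

/-- A Fuchsian system with singularities `u₀ = 1, u₁, …, u_N, u_{N+1} = 0, ∞`, normalized so that
the residue at `0` is upper and the residue at `∞` is lower triangular. `ε₀` and `ε₁` list (with
multiplicity) the eigenvalues of the residues at `0` and at `∞`, i.e. the characteristic exponents
there; at either point, no two of them differ by an integer. -/
structure IsFuchsianSystem {L N : ℕ} (u : Fin (N + 2) → ℂ)
    (A : Fin (N + 2) → Matrix (Fin L) (Fin L) ℂ) (ε₀ ε₁ : Fin L → ℂ) : Prop where
  u_first : u 0 = 1
  u_last : u (Fin.last (N + 1)) = 0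
  u_injective : Function.Injective u
  upper : ∀ i j, j < i → A (Fin.last (N + 1)) i j = 0
  lower : ∀ i j, i < j → residueInfty A i j = 0
  charpoly_zero : (A (Fin.last (N + 1))).charpoly = ∏ j, (Polynomial.X - Polynomial.C (ε₀ j))
  charpoly_infty : (residueInfty A).charpoly = ∏ j, (Polynomial.X - Polynomial.C (ε₁ j))
  nonresonant_zero : ∀ i j, i ≠ j → ∀ m : ℤ, ε₀ i - ε₀ j ≠ m
  nonresonant_infty : ∀ i j, i ≠ j → ∀ m : ℤ, ε₁ i - ε₁ j ≠ m

/-! ## Analytic continuation and monodromy -/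

/-- The complement of the singularities in the Riemann sphere (`∞` being one of them). -/
abbrev RegularPoint {N : ℕ} (u : Fin (N + 2) → ℂ) : Type := {z : ℂ // ∀ i, z ≠ u i}

/-- The germ at `a` of the matrix function `Y` is continued analytically along the path `γ` to the
germ at `b` of `Y'`. Here `y t` represents the germ at `γ t`. -/
def ContinuesTo {L N : ℕ} {u : Fin (N + 2) → ℂ} {a b : RegularPoint u} (γ : Path a b)
    (Y Y' : ℂ → Matrix (Fin L) (Fin L) ℂ) : Prop :=
  ∃ y : unitInterval → ℂ → Matrix (Fin L) (Fin L) ℂ,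
    (∀ t i j, AnalyticAt ℂ (fun z => y t z i j) (γ t : ℂ)) ∧
    (∀ t, ∀ᶠ s in nhds t, y s =ᶠ[nhds (γ s : ℂ)] y t) ∧
    y 0 =ᶠ[nhds (a : ℂ)] Y ∧ y 1 =ᶠ[nhds (b : ℂ)] Y'

/-- `M` is the monodromy matrix of (the multivalued function given by the germ at `z₀` of) `Y`
along the loop `γ`: continuation along `γ` turns `Y` into `Y M`. -/
def IsMonodromyMatrix {L N : ℕ} {u : Fin (N + 2) → ℂ} {z₀ : RegularPoint u} (γ : Path z₀ z₀)
    (Y : ℂ → Matrix (Fin L) (Fin L) ℂ) (M : Matrix (Fin L) (Fin L) ℂ) : Prop :=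
  ContinuesTo γ Y (fun z => Y z * M)

/-! ## Normalized solutions -/

/-- All entries of the matrix `F` of power series converge in the disc of radius `r`. -/
def ConvergesOn {L : ℕ} (F : Matrix (Fin L) (Fin L) (PowerSeries ℂ)) (r : ℝ) : Prop :=
  ∀ i j, ∀ w : ℂ, ‖w‖ < r → Summable fun k : ℕ => PowerSeries.coeff k (F i j) * w ^ k

/-- The sum at `w` of a matrix of (convergent) power series. -/
noncomputable def evalSeries {L : ℕ} (F : Matrix (Fin L) (Fin L) (PowerSeries ℂ)) (w : ℂ) :
    Matrix (Fin L) (Fin L) ℂ :=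
  Matrix.of fun i j => ∑' k : ℕ, PowerSeries.coeff k (F i j) * w ^ k

/-- The constant term of a matrix of power series. -/
noncomputable def constTerm {L : ℕ} (F : Matrix (Fin L) (Fin L) (PowerSeries ℂ)) :
    Matrix (Fin L) (Fin L) ℂ :=
  F.map PowerSeries.constantCoeff

/-- `l` is a branch of the logarithm near `a`. -/
def IsLogBranch (l : ℂ → ℂ) (a : ℂ) : Prop :=
  AnalyticAt ℂ l a ∧ ∀ᶠ z in nhds a, Complex.exp (l z) = z

/-- `diag (z ^ ε_j)`, for the branch `l` of `log z`. -/
noncomputable def diagPow {L : ℕ} (ε : Fin L → ℂ) (l : ℂ → ℂ) (z : ℂ) :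
    Matrix (Fin L) (Fin L) ℂ :=
  Matrix.diagonal fun j => Complex.exp (ε j * l z)

/-- The germ of `Y` at the base point `z₀` is a solution of `dY/dz = A(z) Y` which

* continued along the path `γ₀` to a point `a` near `0` equals `Ψ(z) diag (z ^ ε₀ⱼ)`, where `Ψ` is a
  convergent power series and `Ψ(0)` is upper triangular with ones on the diagonal;
* continued along the path `γ₁` to a point `b` near `∞` equals `Φ(w) diag (w ^ ε₁ⱼ) C`, `w = 1 / z`,
  where `Φ` is a convergent power series, `Φ(0)` is invertible and lower triangular, and `C` (the
  connection matrix) is invertible.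

The branches of the powers are given by the branches `l₀`, `l₁` of `log z` at `a` and at `b`;
in particular `w ^ ε = exp (-ε l₁(z))`. -/
structure IsNormalizedSolution {L N : ℕ} (u : Fin (N + 2) → ℂ)
    (A : Fin (N + 2) → Matrix (Fin L) (Fin L) ℂ) (ε₀ ε₁ : Fin L → ℂ)
    {z₀ a b : RegularPoint u} (γ₀ : Path z₀ a) (γ₁ : Path z₀ b) (l₀ l₁ : ℂ → ℂ)
    (Y : ℂ → Matrix (Fin L) (Fin L) ℂ) (Ψ Φ : Matrix (Fin L) (Fin L) (PowerSeries ℂ))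
    (C : Matrix (Fin L) (Fin L) ℂ) : Prop where
  solves : ∀ᶠ z in nhds (z₀ : ℂ), ∀ i j,
    HasDerivAt (fun x => Y x i j) ((fuchsCoeff u A z * Y z) i j) z
  log_zero : IsLogBranch l₀ a
  log_infty : IsLogBranch l₁ b
  converges_zero : ∃ r : ℝ, ‖(a : ℂ)‖ < r ∧ ConvergesOn Ψ r
  converges_infty : ∃ r : ℝ, ‖(b : ℂ)⁻¹‖ < r ∧ ConvergesOn Φ r
  unitriangular : ∀ i j, j ≤ i → constTerm Ψ i j = if i = j then 1 else 0
  lower : ∀ i j, i < j → constTerm Φ i j = 0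
  invertible : IsUnit (constTerm Φ).det
  connection_invertible : IsUnit C.det
  near_zero : ContinuesTo γ₀ Y fun z => evalSeries Ψ z * diagPow ε₀ l₀ z
  near_infty : ContinuesTo γ₁ Y fun z =>
    evalSeries Φ z⁻¹ * diagPow (fun j => -ε₁ j) l₁ z * C

/-- The shift `(n(L-1), -n, …, -n)` of the exponents at infinity. -/
noncomputable def exponentShift (L n : ℕ) (j : Fin L) : ℂ :=
  if (j : ℕ) = 0 then (n : ℂ) * ((L : ℂ) - 1) else -(n : ℂ)

open Filter Topology

/-! ## Convergent power series -/

/-! The crux is that `R` is unimodular. The approximation condition makes the first column of `Q̃ Φ`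
divisible by `w ^ (nL)`. Removing this factor leaves a matrix `Φ'` with `det Q̃ · det Φ = w ^ (nL) ·
det Φ'`. As `Φ` is invertible, `w ^ (nL)` divides `det Q̃`, so `det R(1/w) = w ^ (-nL) det Q̃(w)` is
a polynomial in `w`. A polynomial in both `z` and `1/z` is constant, and `R(0)` is upper
unitriangular, so `det R = 1`. Comparing constant terms also shows that `Φ'(0)` is invertible
(`IsHermitePade.det_schlesingerMatrix_and_isUnit`).

Hence `R⁻¹` is a polynomial matrix, and `R Y` has the same monodromy as `Y`. It satisfies a system
with coefficient `R' R⁻¹ + R A R⁻¹`, which is a Fuchsian coefficient with residues `R(uᵢ) Aᵢ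
R(uᵢ)⁻¹` plus a polynomial. Near infinity `R Y = Φ' diag (w ^ ε') C`, with `ε'` the shifted
exponents. So the coefficient is `O(1/z)` there, which kills the polynomial, and the residue at
infinity is `Φ'(0) diag(ε') Φ'(0)⁻¹` (`tendsto_mul_coeff_at_infty`, `gaugeCoeff_eq_fuchsCoeff`).
Triangularity at both points follows from that of `R(0)` and `Φ'(0)`. -/

theorem hasSum_coeff_coe_mul {f : PowerSeries ℂ} {w s : ℂ}
    (h : HasSum (fun k : ℕ => PowerSeries.coeff k f * w ^ k) s) (p : Polynomial ℂ) :
    HasSum (fun k : ℕ => PowerSeries.coeff k ((p : PowerSeries ℂ) * f) * w ^ k)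
      (p.eval w * s) := by
  induction p using Polynomial.induction_on with
  | C a => simpa [PowerSeries.coeff_C_mul, mul_assoc] using h.mul_left a
  | add p q hp hq => simpa [add_mul] using hp.add hq
  | monomial m a ih =>
    rw [← hasSum_nat_add_iff' 1]
    convert! ih.mul_left w using 1
    · funext k
      have : ((Polynomial.C a * Polynomial.X ^ (m + 1) : Polynomial ℂ) : PowerSeries ℂ) * f =
          PowerSeries.X * (((Polynomial.C a * Polynomial.X ^ m : Polynomial ℂ) :
            PowerSeries ℂ) * f) := by
        push_cast; ring
      rw [this, PowerSeries.coeff_succ_X_mul]; ring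
    · have : ((Polynomial.C a * Polynomial.X ^ (m + 1) : Polynomial ℂ) : PowerSeries ℂ) * f =
          PowerSeries.X * (((Polynomial.C a * Polynomial.X ^ m : Polynomial ℂ) :
            PowerSeries ℂ) * f) := by
        push_cast; ring
      rw [this]
      simp
      ring

theorem hasSum_coeff_of_X_pow_mul {g : PowerSeries ℂ} {w s : ℂ} (hw : w ≠ 0) (m : ℕ)
    (h : HasSum (fun k : ℕ => PowerSeries.coeff k (PowerSeries.X ^ m * g) * w ^ k) s) :
    HasSum (fun k : ℕ => PowerSeries.coeff k g * w ^ k) ((w ^ m)⁻¹ * s) := by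
  rw [← hasSum_nat_add_iff' m] at h
  have h0 : ∑ k ∈ Finset.range m, PowerSeries.coeff k (PowerSeries.X ^ m * g) * w ^ k = 0 :=
    Finset.sum_eq_zero fun k hk => by
      rw [PowerSeries.coeff_X_pow_mul', if_neg (by simpa using hk), zero_mul]
  rw [h0, sub_zero] at h
  convert! h.mul_left (w ^ m)⁻¹ using 1
  funext k
  rw [PowerSeries.coeff_X_pow_mul, pow_add]
  field_simp

theorem summable_coeff_mul_zero_pow (g : PowerSeries ℂ) :
    Summable fun k : ℕ => PowerSeries.coeff k g * (0 : ℂ) ^ k :=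
  summable_of_ne_finset_zero (s := {0}) fun k hk => by
    simp at hk
    simp [hk]

theorem hasFPowerSeriesOnBall_of_summable {c : ℕ → ℂ} {r : ℝ} (hr : 0 < r)
    (h : ∀ w : ℂ, ‖w‖ < r → Summable fun k => c k * w ^ k) :
    HasFPowerSeriesOnBall (fun w => ∑' k, c k * w ^ k) (.ofScalars ℂ c) 0 (ENNReal.ofReal r) := by
  constructor
  · refine le_of_forall_lt_imp_le_of_dense fun s hs ↦ ?_
    lift s to NNReal using hs.ne_top
    apply FormalMultilinearSeries.le_radius_of_summable
    have hs' : (s : ℝ) < r := by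
      simpa using (ENNReal.lt_ofReal_iff_toReal_lt (ENNReal.coe_ne_top)).1 hs
    -- Over `ℂ` summability is absolute, so the single point `w = s` controls the whole circle of
    -- radius `s`.
    have := (h (s : ℝ) (by simpa using hs')).norm
    simpa [FormalMultilinearSeries.ofScalars_norm] using this
  · simpa using hr
  · intro y hy
    have hy' : ‖y‖ < r := by simpa [Metric.mem_eball, edist_zero_right, ← ofReal_norm, hr] using hy
    simpa [FormalMultilinearSeries.ofScalars_apply_eq, mul_comm] using (h y hy').hasSum

theorem ConvergesOn.analyticAt {L : ℕ} {F : Matrix (Fin L) (Fin L) (PowerSeries ℂ)} {r : ℝ}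
    (hF : ConvergesOn F r) {w : ℂ} (hw : ‖w‖ < r) (i j : Fin L) :
    AnalyticAt ℂ (fun w => evalSeries F w i j) w := by
  have hr : 0 < r := (norm_nonneg w).trans_lt hw
  refine (hasFPowerSeriesOnBall_of_summable hr (hF i j)).analyticOnNhd w ?_
  simpa [Metric.mem_eball, edist_zero_right, ← ofReal_norm, hr] using hw

theorem evalSeries_zero {L : ℕ} (F : Matrix (Fin L) (Fin L) (PowerSeries ℂ)) :
    evalSeries F 0 = constTerm F := by
  ext i j
  simp only [evalSeries, constTerm, Matrix.of_apply, Matrix.map_apply]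
  rw [tsum_eq_single 0 (fun k hk => by simp [hk])]
  simp

/-! ## Analytic continuation -/

/-- Permanence of functional equations. -/
theorem eventuallyEq_zero_of_continuation {γ : unitInterval → ℂ} (hγ : Continuous γ)
    {d : unitInterval → ℂ → ℂ} (hd : ∀ t, AnalyticAt ℂ (d t) (γ t))
    (hloc : ∀ t, ∀ᶠ s in 𝓝 t, d s =ᶠ[𝓝 (γ s)] d t) (h0 : d 0 =ᶠ[𝓝 (γ 0)] 0) :
    d 1 =ᶠ[𝓝 (γ 1)] 0 := by
  have hopen : IsOpen {t | d t =ᶠ[𝓝 (γ t)] 0} := by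
    refine isOpen_iff_mem_nhds.2 fun t ht => ?_
    have h1 := hγ.continuousAt.eventually (eventually_eventually_nhds.2
      (show ∀ᶠ z in 𝓝 (γ t), d t z = 0 from ht))
    filter_upwards [hloc t, h1] with s hs hs'
    exact hs.trans hs'
  have hclosed : IsClosed {t | d t =ᶠ[𝓝 (γ t)] 0} := by
    refine ⟨isOpen_iff_mem_nhds.2 fun t ht => ?_⟩
    have h1 := (hd t).eventually_eq_zero_or_eventually_ne_zero.resolve_left ht
    have h2 := hγ.continuousAt.eventually
      (eventually_eventually_nhds.2 (eventually_nhdsWithin_iff.1 h1))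
    filter_upwards [hloc t, h2] with s hs hs' (hs0 : d s =ᶠ[𝓝 (γ s)] 0)
    -- Here `d t` vanishes near `γ s` but nowhere near it except possibly at `γ t`. That would make
    -- `γ s` an isolated point of `ℂ`.
    have h3 : ∀ᶠ x in 𝓝 (γ s), x = γ t := by
      filter_upwards [hs.symm.trans hs0, hs'] with x hx hx'
      by_contra hne
      exact hx' hne hx
    have h4 := h3.self_of_nhds
    rw [← h4] at h3
    obtain ⟨x, hx, hx'⟩ := ((h3.filter_mono nhdsWithin_le_nhds).and
      (self_mem_nhdsWithin : ∀ᶠ x in 𝓝[≠] (γ s), x ∈ ({γ s}ᶜ : Set ℂ))).exists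
    exact hx' hx
  have := Set.eq_univ_iff_forall.1 (IsClopen.eq_univ ⟨hclosed, hopen⟩ ⟨0, h0⟩)
  exact this 1

section

variable {L N : ℕ} {u : Fin (N + 2) → ℂ} {a b : RegularPoint u} {γ : Path a b}
  {Y Y' : ℂ → Matrix (Fin L) (Fin L) ℂ}

theorem ContinuesTo.congr {X X' : ℂ → Matrix (Fin L) (Fin L) ℂ} (h : ContinuesTo γ Y Y')
    (hX : Y =ᶠ[𝓝 (a : ℂ)] X) (hX' : Y' =ᶠ[𝓝 (b : ℂ)] X') : ContinuesTo γ X X' := by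
  obtain ⟨y, h1, h2, h3, h4⟩ := h
  exact ⟨y, h1, h2, h3.trans hX, h4.trans hX'⟩

theorem analyticAt_eval (p : Polynomial ℂ) (z : ℂ) : AnalyticAt ℂ (fun z => p.eval z) z := by
  simpa using! (analyticAt_id (𝕜 := ℂ) (z := z)).aeval_polynomial p

theorem analyticAt_mul_apply {B X : ℂ → Matrix (Fin L) (Fin L) ℂ} {z : ℂ}
    (hB : ∀ i j, AnalyticAt ℂ (fun z => B z i j) z)
    (hX : ∀ i j, AnalyticAt ℂ (fun z => X z i j) z) (i j : Fin L) :
    AnalyticAt ℂ (fun z => (B z * X z) i j) z := by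
  simp only [Matrix.mul_apply]
  exact Finset.analyticAt_fun_sum _ fun k _ => (hB i k).mul (hX k j)

/-- Polynomials are entire and single-valued, so a polynomial factor on the left passes through
continuation. Applied to `R` and to `R⁻¹`, this yields both directions of the monodromy statement.
-/
theorem ContinuesTo.evalPoly_mul (h : ContinuesTo γ Y Y')
    (P : Matrix (Fin L) (Fin L) (Polynomial ℂ)) :
    ContinuesTo γ (fun z => evalPoly P z * Y z) (fun z => evalPoly P z * Y' z) := by
  obtain ⟨y, h1, h2, h3, h4⟩ := h
  refine ⟨fun t z => evalPoly P z * y t z, fun t => analyticAt_mul_apply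
    (fun i j => analyticAt_eval (P i j) _) (h1 t), fun t => ?_, ?_, ?_⟩
  · filter_upwards [h2 t] with s hs
    filter_upwards [hs] with z hz
    rw [hz]
  · filter_upwards [h3] with z hz
    rw [hz]
  · filter_upwards [h4] with z hz
    rw [hz]

/-- Analytic continuation preserves linear differential equations. -/
theorem ContinuesTo.hasDerivAt (h : ContinuesTo γ Y Y') {B : ℂ → Matrix (Fin L) (Fin L) ℂ}
    (hB : ∀ z, (∀ i, z ≠ u i) → ∀ i j, AnalyticAt ℂ (fun z => B z i j) z)
    (hY : ∀ᶠ z in 𝓝 (a : ℂ), ∀ i j, HasDerivAt (fun x => Y x i j) ((B z * Y z) i j) z) :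
    ∀ᶠ z in 𝓝 (b : ℂ), ∀ i j, HasDerivAt (fun x => Y' x i j) ((B z * Y' z) i j) z := by
  obtain ⟨y, h1, h2, h3, h4⟩ := h
  refine eventually_all.2 fun i => eventually_all.2 fun j => ?_
  have key : (fun z => deriv (fun x => y 1 x i j) z - (B z * y 1 z) i j)
      =ᶠ[𝓝 (γ 1 : ℂ)] 0 := by
    refine eventuallyEq_zero_of_continuation (γ := fun t => (γ t : ℂ)) (by fun_prop)
      (d := fun t z => deriv (fun x => y t x i j) z - (B z * y t z) i j)
      (fun t => ((h1 t i j).deriv).sub (analyticAt_mul_apply (hB _ (γ t).2) (h1 t) i j))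
      (fun t => ?_) ?_
    · filter_upwards [h2 t] with s hs
      have hs' : (fun x => y s x i j) =ᶠ[𝓝 (γ s : ℂ)] fun x => y t x i j :=
        hs.mono fun z hz => by simp only [hz]
      filter_upwards [hs, hs'.deriv] with z hz hz'
      rw [hz, hz']
    · rw [γ.source]
      have h3' : (fun x => y 0 x i j) =ᶠ[𝓝 (a : ℂ)] fun x => Y x i j :=
        h3.mono fun z hz => by simp only [hz]
      filter_upwards [h3, h3'.deriv, hY] with z hz hz' hYz
      simp [hz, hz', (hYz i j).deriv]
  have h1' := (h1 1 i j).eventually_analyticAt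
  rw [γ.target] at key h1'
  have h4' : (fun x => y 1 x i j) =ᶠ[𝓝 (b : ℂ)] fun x => Y' x i j :=
    h4.mono fun z hz => by simp only [hz]
  filter_upwards [key, h1', h4, h4'.eventuallyEq_nhds] with z hz hz' hz4 hz4'
  rw [← hz4, ← sub_eq_zero.1 hz]
  exact hz'.differentiableAt.hasDerivAt.congr_of_eventuallyEq hz4'.symm

end

/-! ## The residue at infinity -/

theorem IsLogBranch.eventually_hasDerivAt {l : ℂ → ℂ} {a : ℂ} (h : IsLogBranch l a) :
    ∀ᶠ z in 𝓝 a, HasDerivAt l z⁻¹ z ∧ Complex.exp (l z) = z := by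
  filter_upwards [h.1.eventually_analyticAt, h.2.eventually_nhds] with z hz hz'
  have h1 := hz.differentiableAt.hasDerivAt
  have h2 : HasDerivAt (fun z => Complex.exp (l z)) 1 z :=
    (hasDerivAt_id z).congr_of_eventuallyEq hz'
  have h3 := h1.cexp.unique h2
  rw [hz'.self_of_nhds] at h3
  refine ⟨?_, hz'.self_of_nhds⟩
  rwa [eq_inv_of_mul_eq_one_right h3] at h1

theorem hasDerivAt_mul_const_apply {L : ℕ} {X : ℂ → Matrix (Fin L) (Fin L) ℂ}
    {B C : Matrix (Fin L) (Fin L) ℂ} {z : ℂ}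
    (h : ∀ i j, HasDerivAt (fun x => X x i j) ((B * X z) i j) z) (i j : Fin L) :
    HasDerivAt (fun x => (X x * C) i j) ((B * (X z * C)) i j) z := by
  rw [← mul_assoc]
  simp only [Matrix.mul_apply (N := C)]
  exact HasDerivAt.fun_sum fun k _ => (h i k).mul_const (C k j)

section

variable {L : ℕ} {B : ℂ → Matrix (Fin L) (Fin L) ℂ} {F : Matrix (Fin L) (Fin L) (PowerSeries ℂ)}
  {r : ℝ} {b : ℂ} {l : ℂ → ℂ} {C : Matrix (Fin L) (Fin L) ℂ} {E : Fin L → ℂ}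

/-- In the variable `w = 1/z` the multivalued factors drop out: `C` is cancelled on the right, then
the nonzero exponential is divided out of each column. What remains involves only functions
meromorphic in `w` once `B` is. -/
theorem eventually_ode_evalSeries (hF : ConvergesOn F r) (hb : b ≠ 0) (hbr : ‖b⁻¹‖ < r)
    (hl : IsLogBranch l b) (hC : IsUnit C.det)
    (ode : ∀ᶠ z in 𝓝 b, ∀ i j,
      HasDerivAt (fun x => (evalSeries F x⁻¹ * diagPow (fun j => -E j) l x * C) i j)
        ((B z * (evalSeries F z⁻¹ * diagPow (fun j => -E j) l z * C)) i j) z) (i k : Fin L) :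
    ∀ᶠ w in 𝓝 b⁻¹, w * deriv (fun w => evalSeries F w i k) w + evalSeries F w i k * E k
      + w⁻¹ * (B w⁻¹ * evalSeries F w) i k = 0 := by
  have hinv : Tendsto (fun w : ℂ => w⁻¹) (𝓝 b⁻¹) (𝓝 b) := by
    simpa using (tendsto_inv₀ (inv_ne_zero hb))
  have hball : ∀ᶠ w in 𝓝 b⁻¹, ‖w‖ < r := continuous_norm.continuousAt.eventually_lt_const hbr
  filter_upwards [hinv.eventually ode, hinv.eventually hl.eventually_hasDerivAt, hball,
    (continuousAt_id).eventually_ne (inv_ne_zero hb)] with w hw hlw hwr (hw0 : w ≠ 0)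
  obtain ⟨hlw, -⟩ := hlw
  have h1 := hasDerivAt_mul_const_apply (C := C⁻¹) hw i k
  simp only [Matrix.mul_nonsing_inv_cancel_right _ _ hC] at h1
  have h2 : HasDerivAt (fun x => evalSeries F x⁻¹ i k * Complex.exp (-E k * l x))
      (deriv (fun w => evalSeries F w i k) w * (-((w⁻¹) ^ 2)⁻¹) * Complex.exp (-E k * l w⁻¹) +
        evalSeries F w i k * (Complex.exp (-E k * l w⁻¹) * (-E k * w⁻¹⁻¹))) w⁻¹ := by
    have h3 : HasDerivAt (fun w => evalSeries F w i k)
        (deriv (fun w => evalSeries F w i k) w) (w⁻¹)⁻¹ := by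
      rw [inv_inv]
      exact (hF.analyticAt hwr i k).differentiableAt.hasDerivAt
    have h4 := (h3.comp (w⁻¹) (hasDerivAt_inv (inv_ne_zero hw0))).mul
      (hlw.const_mul (-E k)).cexp
    simpa using! h4
  have h5 : (fun x => (evalSeries F x⁻¹ * diagPow (fun j => -E j) l x) i k) =
      fun x => evalSeries F x⁻¹ i k * Complex.exp (-E k * l x) := by
    funext x
    simp [diagPow, Matrix.mul_diagonal]
  rw [h5] at h1
  have h6 := h1.unique h2
  rw [← mul_assoc, diagPow, Matrix.mul_diagonal, inv_inv] at h6
  have he := Complex.exp_ne_zero (-E k * l w⁻¹)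
  have h7 : (B w⁻¹ * evalSeries F w) i k =
      deriv (fun w => evalSeries F w i k) w * (-((w⁻¹) ^ 2)⁻¹) +
        evalSeries F w i k * (-E k * w) := by
    apply mul_right_cancel₀ he
    rw [h6]; ring
  rw [h7]
  field_simp
  ring

/-- Solving the equation for the coefficient gives `w⁻¹ B(1/w) = -(w F' + F E) F⁻¹`, whose right
side is continuous at `0` because `F(0)` is invertible. -/
theorem tendsto_mul_coeff_at_infty (hF : ConvergesOn F r) (hb : b ≠ 0) (hbr : ‖b⁻¹‖ < r)
    (hB : ∀ i j, Meromorphic fun w => B w⁻¹ i j)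
    (hl : IsLogBranch l b) (hC : IsUnit C.det) (h0 : IsUnit (constTerm F).det)
    (ode : ∀ᶠ z in 𝓝 b, ∀ i j,
      HasDerivAt (fun x => (evalSeries F x⁻¹ * diagPow (fun j => -E j) l x * C) i j)
        ((B z * (evalSeries F z⁻¹ * diagPow (fun j => -E j) l z * C)) i j) z) :
    Tendsto (fun w => w⁻¹ • B w⁻¹) (𝓝[≠] 0)
      (𝓝 (-(constTerm F * Matrix.diagonal E * (constTerm F)⁻¹))) := by
  have hr : 0 < r := (norm_nonneg _).trans_lt hbr
  have hFan : ∀ w ∈ Metric.ball (0 : ℂ) r, ∀ i k,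
      AnalyticAt ℂ (fun w => evalSeries F w i k) w := fun w hw =>
    hF.analyticAt (by simpa using hw)
  have h1 : ∀ i k, ∀ᶠ w in 𝓝[≠] (0 : ℂ),
      w * deriv (fun w => evalSeries F w i k) w + evalSeries F w i k * E k
        + w⁻¹ * (B w⁻¹ * evalSeries F w) i k = 0 := by
    intro i k
    have hmer : MeromorphicOn (fun w => w * deriv (fun w => evalSeries F w i k) w
        + evalSeries F w i k * E k + w⁻¹ * (B w⁻¹ * evalSeries F w) i k) (Metric.ball 0 r) := by
      intro w hw
      have hid : MeromorphicAt (fun w : ℂ => w) w := MeromorphicAt.id w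
      refine ((hid.mul (hFan w hw i k).deriv.meromorphicAt).add
        ((hFan w hw i k).meromorphicAt.mul (.const _ _))).add (hid.inv.mul ?_)
      simp only [Matrix.mul_apply]
      exact MeromorphicAt.fun_sum fun j _ => (hB i j w).mul (hFan w hw j k).meromorphicAt
    rw [← meromorphicOrderAt_eq_top_iff]
    by_contra hne
    -- The equation is known only near `b⁻¹`. The identity theorem for meromorphic functions on the
    -- disc carries it to a punctured neighbourhood of `0`.
    refine hmer.meromorphicOrderAt_ne_top_of_isPreconnected (y := b⁻¹)
      (convex_ball (0 : ℂ) r).isPreconnected (Metric.mem_ball_self hr) (by simpa using hbr) hne ?_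
    rw [meromorphicOrderAt_eq_top_iff]
    exact (eventually_ode_evalSeries hF hb hbr hl hC ode i k).filter_mono nhdsWithin_le_nhds
  have hF0 : Tendsto (evalSeries F) (𝓝 0) (𝓝 (constTerm F)) := by
    rw [← evalSeries_zero]
    exact tendsto_pi_nhds.2 fun i => tendsto_pi_nhds.2 fun k =>
      (hFan 0 (Metric.mem_ball_self hr) i k).continuousAt
  have hdet : Tendsto (fun w => (evalSeries F w).det) (𝓝 0) (𝓝 (constTerm F).det) :=
    (Continuous.matrix_det continuous_id).continuousAt.tendsto.comp hF0
  have hinv : Tendsto (fun w => (evalSeries F w)⁻¹) (𝓝 0) (𝓝 (constTerm F)⁻¹) := by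
    simp only [Matrix.inv_def, Ring.inverse_eq_inv']
    exact (hdet.inv₀ h0.ne_zero).smul
      ((Continuous.matrix_adjugate continuous_id).continuousAt.tendsto.comp hF0)
  have hlim : Tendsto (fun w => (Matrix.of fun i k =>
      -(w * deriv (fun w => evalSeries F w i k) w + evalSeries F w i k * E k)) *
        (evalSeries F w)⁻¹) (𝓝 0)
      (𝓝 (-(constTerm F * Matrix.diagonal E * (constTerm F)⁻¹))) := by
    rw [← Matrix.neg_mul]
    refine Tendsto.mul (tendsto_pi_nhds.2 fun i => tendsto_pi_nhds.2 fun k => ?_) hinv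
    have h2 := hFan 0 (Metric.mem_ball_self hr) i k
    have h3 : Tendsto (fun w => -(w * deriv (fun w => evalSeries F w i k) w
        + evalSeries F w i k * E k)) (𝓝 0) (𝓝 (-(0 * deriv (fun w => evalSeries F w i k) 0
          + evalSeries F 0 i k * E k))) :=
      ((tendsto_id.mul h2.deriv.continuousAt).add
        (h2.continuousAt.tendsto.mul_const (E k))).neg
    simpa [evalSeries_zero, Matrix.mul_diagonal] using h3
  refine (hlim.mono_left nhdsWithin_le_nhds).congr' ?_
  filter_upwards [eventually_all.2 fun i => eventually_all.2 (h1 i),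
    (hdet.mono_left nhdsWithin_le_nhds).eventually_ne h0.ne_zero] with w hw hwd
  have h4 : (Matrix.of fun i k =>
      -(w * deriv (fun w => evalSeries F w i k) w + evalSeries F w i k * E k)) =
      w⁻¹ • B w⁻¹ * evalSeries F w := by
    ext i k
    rw [Matrix.of_apply, Matrix.smul_mul, Matrix.smul_apply, smul_eq_mul]
    linear_combination -hw i k
  rw [h4, Matrix.mul_nonsing_inv_cancel_right _ _ (isUnit_iff_ne_zero.2 hwd)]

end

/-- A polynomial with a finite limit at infinity is constant. -/
theorem Polynomial.eq_C_of_tendsto_inv {p : Polynomial ℂ} {c : ℂ}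
    (h : Tendsto (fun w => p.eval w⁻¹) (𝓝[≠] 0) (𝓝 c)) : p = Polynomial.C c := by
  have hp : p.degree ≤ 0 := by
    by_contra! hp
    have h1 : Tendsto (fun w : ℂ => ‖p.eval w⁻¹‖) (𝓝[≠] 0) atTop :=
      p.tendsto_norm_atTop hp (tendsto_norm_inv_nhdsNE_zero_atTop)
    exact not_tendsto_atTop_of_tendsto_nhds h.norm h1
  rw [Polynomial.eq_C_of_degree_le_zero hp] at h ⊢
  simp only [Polynomial.eval_C] at h
  rw [tendsto_nhds_unique tendsto_const_nhds h]

/-! ## The Hermite–Padé polynomial matrix -/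

section

variable {L n : ℕ} {Q : Fin L → Fin L → Polynomial ℂ}

theorem IsHermitePade.natDegree_tildeQ_le {f : Fin L → PowerSeries ℂ} (hQ : IsHermitePade n f Q)
    (i j : Fin L) : (tildeQ Q i j).natDegree ≤ n := by
  have h := Polynomial.degree_lt_iff_coeff_zero _ _ |>.1 (hQ.degree_lt i j)
  rw [Polynomial.natDegree_le_iff_coeff_eq_zero]
  intro m hm
  rw [tildeQ]
  split_ifs with hij
  -- Above the diagonal `Q i j` has degree below `n`, which leaves room for the extra factor `w`.
  · obtain ⟨k, rfl⟩ : ∃ k, m = k + 1 := ⟨m - 1, by omega⟩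
    rw [Polynomial.coeff_X_mul]
    exact h k (by rw [if_neg hij.ne]; omega)
  · exact h m (by split_ifs <;> omega)

theorem IsHermitePade.coeff_tildeQ {f : Fin L → PowerSeries ℂ} (hQ : IsHermitePade n f Q)
    {i j : Fin L} (hij : j ≤ i) : (tildeQ Q i j).coeff n = if i = j then 1 else 0 := by
  rw [tildeQ, if_neg hij.not_gt]
  split_ifs with h
  · subst h
    exact hQ.normalized i
  · exact Polynomial.degree_lt_iff_coeff_zero _ _ |>.1 (hQ.degree_lt i j) n (by simp [h])

/-- Reversal turns the coefficient of `w ^ n` into the value at `z = 0`. The degree bounds and the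
monic normalization therefore make `R(0)` upper unitriangular. -/
theorem IsHermitePade.evalPoly_schlesingerMatrix_zero {f : Fin L → PowerSeries ℂ}
    (hQ : IsHermitePade n f Q) {i j : Fin L} (hij : j ≤ i) :
    evalPoly (schlesingerMatrix n Q) 0 i j = if i = j then 1 else 0 := by
  rw [← hQ.coeff_tildeQ hij, evalPoly, Matrix.map_apply, schlesingerMatrix, Matrix.of_apply,
    ← Polynomial.coeff_zero_eq_eval_zero, Polynomial.coeff_reflect,
    Polynomial.revAt_le (Nat.zero_le n), Nat.sub_zero]

theorem IsHermitePade.eval_schlesingerMatrix {f : Fin L → PowerSeries ℂ}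
    (hQ : IsHermitePade n f Q) {z : ℂ} (hz : z ≠ 0) (i j : Fin L) :
    evalPoly (schlesingerMatrix n Q) z i j = z ^ n * (tildeQ Q i j).eval z⁻¹ := by
  have : Invertible z⁻¹ := invertibleOfNonzero (inv_ne_zero hz)
  have h := Polynomial.eval₂_reflect_mul_pow (RingHom.id ℂ) z⁻¹ n _ (hQ.natDegree_tildeQ_le i j)
  rw [invOf_eq_inv, inv_inv] at h
  simp only [Polynomial.eval₂_id] at h
  rw [← h, evalPoly, Matrix.map_apply, schlesingerMatrix, Matrix.of_apply,
    mul_left_comm, ← mul_pow, mul_inv_cancel₀ hz, one_pow, mul_one]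

theorem evalPoly_mul (P Q : Matrix (Fin L) (Fin L) (Polynomial ℂ)) (z : ℂ) :
    evalPoly (P * Q) z = evalPoly P z * evalPoly Q z :=
  map_mul (Polynomial.evalRingHom z).mapMatrix P Q

theorem evalPoly_one (z : ℂ) :
    evalPoly (1 : Matrix (Fin L) (Fin L) (Polynomial ℂ)) z = 1 :=
  map_one (Polynomial.evalRingHom z).mapMatrix

theorem eval_det_eq (P : Matrix (Fin L) (Fin L) (Polynomial ℂ)) (z : ℂ) :
    P.det.eval z = (evalPoly P z).det :=
  (Polynomial.evalRingHom z).map_det P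

theorem constantCoeff_det (F : Matrix (Fin L) (Fin L) (PowerSeries ℂ)) :
    PowerSeries.constantCoeff F.det = (constTerm F).det :=
  PowerSeries.constantCoeff.map_det F

/-- `Φ'` is the analytic factor at infinity of the transformed solution. -/
def IsShiftedFactor (n : ℕ) (Q : Fin L → Fin L → Polynomial ℂ)
    (Φ Φ' : Matrix (Fin L) (Fin L) (PowerSeries ℂ)) : Prop :=
  ∀ i k, ∑ j, (tildeQ Q i j : PowerSeries ℂ) * Φ j k =
    PowerSeries.X ^ (if (k : ℕ) = 0 then n * L else 0) * Φ' i k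

theorem IsHermitePade.exists_isShiftedFactor (hL : 0 < L)
    {Φ : Matrix (Fin L) (Fin L) (PowerSeries ℂ)}
    (hQ : IsHermitePade n (fun i => Φ i ⟨0, hL⟩) Q) : ∃ Φ', IsShiftedFactor n Q Φ Φ' := by
  have h : ∀ i k, ∃ g, ∑ j, (tildeQ Q i j : PowerSeries ℂ) * Φ j k =
      PowerSeries.X ^ (if (k : ℕ) = 0 then n * L else 0) * g := by
    intro i k
    split_ifs with hk
    · obtain rfl : k = ⟨0, hL⟩ := Fin.ext hk
      exact hQ.approx i
    · exact ⟨_, by rw [pow_zero, one_mul]⟩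
  choose Φ' hΦ' using h
  exact ⟨Matrix.of Φ', hΦ'⟩

theorem IsShiftedFactor.hasSum {Φ Φ' : Matrix (Fin L) (Fin L) (PowerSeries ℂ)}
    (h : IsShiftedFactor n Q Φ Φ') {r : ℝ} (hΦ : ConvergesOn Φ r) {w : ℂ} (hw : ‖w‖ < r)
    (hw0 : w ≠ 0) (i k : Fin L) :
    HasSum (fun m : ℕ => PowerSeries.coeff m (Φ' i k) * w ^ m)
      ((w ^ (if (k : ℕ) = 0 then n * L else 0))⁻¹ *
        ∑ j, (tildeQ Q i j).eval w * evalSeries Φ w j k) := by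
  refine hasSum_coeff_of_X_pow_mul hw0 _ ?_
  rw [← h i k]
  simp only [map_sum, Finset.sum_mul]
  exact hasSum_sum fun j _ => hasSum_coeff_coe_mul (hΦ j k w hw).hasSum _

theorem IsShiftedFactor.convergesOn {Φ Φ' : Matrix (Fin L) (Fin L) (PowerSeries ℂ)}
    (h : IsShiftedFactor n Q Φ Φ') {r : ℝ} (hΦ : ConvergesOn Φ r) : ConvergesOn Φ' r := by
  intro i k w hw
  -- `IsShiftedFactor.hasSum` divides by a power of `w`, so the centre is treated separately.
  rcases eq_or_ne w 0 with rfl | hw0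
  · exact summable_coeff_mul_zero_pow _
  · exact (h.hasSum hΦ hw hw0 i k).summable

/-- This is the purpose of the extra factor `w` in `tildeQ`: it kills the terms with `i < j` at `w =
0`, while `j ≤ i < k` is covered by the triangularity of `Φ(0)`. Since `k` is not the first column,
no power of `w` has been removed. -/
theorem IsShiftedFactor.lower {Φ Φ' : Matrix (Fin L) (Fin L) (PowerSeries ℂ)}
    (h : IsShiftedFactor n Q Φ Φ') (hΦ : ∀ i j, i < j → constTerm Φ i j = 0) {i k : Fin L}
    (hik : i < k) : constTerm Φ' i k = 0 := by
  have h1 := congrArg PowerSeries.constantCoeff (h i k)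
  have hk : (k : ℕ) ≠ 0 := by have := Fin.lt_def.1 hik; omega
  rw [if_neg hk, pow_zero, one_mul] at h1
  rw [constTerm, Matrix.map_apply, ← h1, map_sum]
  refine Finset.sum_eq_zero fun j _ => ?_
  rw [map_mul]
  rcases lt_or_ge i j with hij | hij
  · rw [tildeQ, if_pos hij]
    simp
  · have := hΦ j k (hij.trans_lt hik)
    rw [constTerm, Matrix.map_apply] at this
    rw [this, mul_zero]

theorem IsShiftedFactor.det_eq (hL : 0 < L) {Φ Φ' : Matrix (Fin L) (Fin L) (PowerSeries ℂ)}
    (h : IsShiftedFactor n Q Φ Φ') :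
    ((Matrix.of (tildeQ Q)).det : PowerSeries ℂ) * Φ.det = Φ'.det * PowerSeries.X ^ (n * L) := by
  have h1 : Polynomial.coeToPowerSeries.ringHom.mapMatrix (Matrix.of (tildeQ Q)) * Φ =
      Φ' * Matrix.diagonal fun k : Fin L =>
        PowerSeries.X ^ (if (k : ℕ) = 0 then n * L else 0) := by
    ext1 i k
    rw [Matrix.mul_diagonal, mul_comm, ← h i k, Matrix.mul_apply]
    rfl
  have h2 := congrArg Matrix.det h1
  rw [Matrix.det_mul, Matrix.det_mul, Matrix.det_diagonal, ← RingHom.map_det,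
    Finset.prod_eq_single ⟨0, hL⟩ (fun k _ hk => by
      rw [if_neg (fun h0 => hk (Fin.ext h0)), pow_zero]) (by simp)] at h2
  simpa using h2

/-- The quotient `p = det Q̃ / w ^ (nL)` serves twice: `det R(1/w) = p(w)` bounds `det R` at
infinity, and `p · det Φ = det Φ'` with `p(0) = 1` makes `Φ'(0)` invertible. -/
theorem IsHermitePade.det_schlesingerMatrix_and_isUnit (hL : 0 < L)
    {f : Fin L → PowerSeries ℂ} (hQ : IsHermitePade n f Q)
    {Φ Φ' : Matrix (Fin L) (Fin L) (PowerSeries ℂ)} (h : IsShiftedFactor n Q Φ Φ')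
    (hΦ : IsUnit (constTerm Φ).det) :
    (schlesingerMatrix n Q).det = 1 ∧ IsUnit (constTerm Φ').det := by
  have hdet := h.det_eq hL
  have hu : IsUnit Φ.det := by
    rw [PowerSeries.isUnit_iff_constantCoeff, constantCoeff_det]
    exact hΦ
  have hdvd : (PowerSeries.X : PowerSeries ℂ) ^ (n * L) ∣
      ((Matrix.of (tildeQ Q)).det : PowerSeries ℂ) :=
    (hu.dvd_mul_right).1 ⟨Φ'.det, by rw [hdet, mul_comm]⟩
  -- Divisibility by a power of `X` is a condition on coefficients, so it descends from power series
  -- to polynomials.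
  obtain ⟨p, hp⟩ : Polynomial.X ^ (n * L) ∣ (Matrix.of (tildeQ Q)).det := by
    rw [Polynomial.X_pow_dvd_iff]
    intro d hd
    rw [← Polynomial.coeff_coe]
    exact PowerSeries.X_pow_dvd_iff.1 hdvd d hd
  have heval : ∀ w : ℂ, w ≠ 0 → (schlesingerMatrix n Q).det.eval w⁻¹ = p.eval w := by
    intro w hw
    have h1 : evalPoly (schlesingerMatrix n Q) w⁻¹ =
        (w⁻¹ ^ n) • evalPoly (Matrix.of (tildeQ Q)) w := by
      ext i j
      rw [hQ.eval_schlesingerMatrix (inv_ne_zero hw), inv_inv]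
      rfl
    rw [eval_det_eq, h1, Matrix.det_smul, ← eval_det_eq, hp, Fintype.card_fin]
    simp only [Polynomial.eval_mul, Polynomial.eval_pow, Polynomial.eval_X]
    rw [← pow_mul, inv_pow, inv_mul_cancel_left₀ (pow_ne_zero _ hw)]
  have hC : (schlesingerMatrix n Q).det = Polynomial.C (p.eval 0) := by
    refine Polynomial.eq_C_of_tendsto_inv ?_
    refine ((p.continuous.tendsto 0).mono_left nhdsWithin_le_nhds).congr' ?_
    filter_upwards [self_mem_nhdsWithin] with w hw
    exact (heval w hw).symm
  have h0 : (schlesingerMatrix n Q).det.eval 0 = 1 := by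
    rw [eval_det_eq, Matrix.det_of_isUpperTriangular]
    · exact Finset.prod_eq_one fun i _ => by
        simpa using hQ.evalPoly_schlesingerMatrix_zero (le_refl i)
    · intro i j hij
      have hij : j < i := hij
      rw [hQ.evalPoly_schlesingerMatrix_zero hij.le, if_neg hij.ne']
  have hp0 : p.eval 0 = 1 := by rw [← h0, hC, Polynomial.eval_C]
  refine ⟨by rw [hC, hp0, map_one], ?_⟩
  have h2 : (p : PowerSeries ℂ) * Φ.det = Φ'.det := by
    have hX : (PowerSeries.X : PowerSeries ℂ) ^ (n * L) ≠ 0 :=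
      pow_ne_zero _ PowerSeries.X_ne_zero
    apply mul_left_cancel₀ hX
    rw [mul_comm _ Φ'.det, ← hdet, hp]
    push_cast
    ring
  have h3 := congrArg PowerSeries.constantCoeff h2
  rw [map_mul, constantCoeff_det, constantCoeff_det, Polynomial.constantCoeff_coe,
    Polynomial.coeff_zero_eq_eval_zero, hp0, one_mul] at h3
  rwa [← h3]

/-- The prefactor `z ^ n = w ^ (-n)` lowers every exponent by `n`. The power `w ^ (nL)` extracted
from the first column raises that one by `nL`. -/
theorem IsShiftedFactor.evalPoly_mul_eq {f : Fin L → PowerSeries ℂ} (hQ : IsHermitePade n f Q)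
    {Φ Φ' : Matrix (Fin L) (Fin L) (PowerSeries ℂ)} (h : IsShiftedFactor n Q Φ Φ') {r : ℝ}
    (hΦ : ConvergesOn Φ r) {z : ℂ} (hz : ‖z⁻¹‖ < r) {l : ℂ → ℂ} (hl : Complex.exp (l z) = z)
    (ε : Fin L → ℂ) :
    evalPoly (schlesingerMatrix n Q) z * (evalSeries Φ z⁻¹ * diagPow (fun j => -ε j) l z) =
      evalSeries Φ' z⁻¹ * diagPow (fun j => -(ε + exponentShift L n) j) l z := by
  have hz0 : z ≠ 0 := hl ▸ Complex.exp_ne_zero _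
  rw [← mul_assoc]
  ext i k
  rw [diagPow, diagPow, Matrix.mul_diagonal, Matrix.mul_diagonal, Matrix.mul_apply]
  have h1 : evalSeries Φ' z⁻¹ i k = _ := (h.hasSum hΦ hz (inv_ne_zero hz0) i k).tsum_eq
  rw [h1]
  have h2 : Complex.exp (-(ε + exponentShift L n) k * l z) =
      z ^ n * z⁻¹ ^ (if (k : ℕ) = 0 then n * L else 0) * Complex.exp (-ε k * l z) := by
    have hn : z ^ n = Complex.exp (n * l z) := by rw [Complex.exp_nat_mul, hl]
    have hnL : z⁻¹ ^ (n * L) = Complex.exp (((n * L : ℕ) : ℂ) * -l z) := by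
      rw [Complex.exp_nat_mul, Complex.exp_neg, hl]
    rw [Pi.add_apply, exponentShift]
    split_ifs
    · rw [hn, hnL, ← Complex.exp_add, ← Complex.exp_add]
      congr 1
      push_cast
      ring
    · rw [hn, pow_zero, mul_one, ← Complex.exp_add]
      congr 1
      ring
  rw [h2]
  simp only [hQ.eval_schlesingerMatrix hz0, mul_assoc, ← Finset.mul_sum]
  have h3 : z⁻¹ ^ (if (k : ℕ) = 0 then n * L else 0) ≠ 0 := pow_ne_zero _ (inv_ne_zero hz0)
  generalize z⁻¹ ^ (if (k : ℕ) = 0 then n * L else 0) = s at h3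
  generalize (∑ j, (tildeQ Q i j).eval z⁻¹ * evalSeries Φ z⁻¹ j k) = t
  field_simp

end

/-! ## The transformed system -/

section

variable {L N : ℕ} {u : Fin (N + 2) → ℂ} {A : Fin (N + 2) → Matrix (Fin L) (Fin L) ℂ}

theorem tendsto_smul_fuchsCoeff (u : Fin (N + 2) → ℂ)
    (A : Fin (N + 2) → Matrix (Fin L) (Fin L) ℂ) :
    Tendsto (fun w => w⁻¹ • fuchsCoeff u A w⁻¹) (𝓝[≠] 0) (𝓝 (∑ i, A i)) := by
  have h : Tendsto (fun w : ℂ => ∑ i, (1 - u i * w)⁻¹ • A i) (𝓝 0)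
      (𝓝 (∑ i, (1 - u i * 0)⁻¹ • A i)) := by
    refine tendsto_finsetSum _ fun i _ => (Tendsto.inv₀ ?_ (by simp)).smul_const _
    exact (Continuous.tendsto (by fun_prop) 0)
  simp only [mul_zero, sub_zero, inv_one, one_smul] at h
  refine (h.mono_left nhdsWithin_le_nhds).congr' ?_
  filter_upwards [self_mem_nhdsWithin] with w (hw : w ≠ 0)
  rw [fuchsCoeff, Finset.smul_sum]
  refine Finset.sum_congr rfl fun i _ => ?_
  rw [smul_smul, ← mul_inv, mul_sub, mul_inv_cancel₀ hw, mul_comm w]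

/-- The coefficient of the system obtained from `dY/dz = A(z) Y` by `Y ↦ R Y`,
for `S = R⁻¹`. -/
noncomputable def gaugeCoeff (u : Fin (N + 2) → ℂ) (A : Fin (N + 2) → Matrix (Fin L) (Fin L) ℂ)
    (R S : Matrix (Fin L) (Fin L) (Polynomial ℂ)) (z : ℂ) : Matrix (Fin L) (Fin L) ℂ :=
  evalPoly (R.map Polynomial.derivative) z * evalPoly S z +
    evalPoly R z * fuchsCoeff u A z * evalPoly S z

/-- The residues at the finite singularities after `Y ↦ R Y`, for `S = R⁻¹`. -/
noncomputable def gaugeResidue (u : Fin (N + 2) → ℂ)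
    (A : Fin (N + 2) → Matrix (Fin L) (Fin L) ℂ)
    (R S : Matrix (Fin L) (Fin L) (Polynomial ℂ)) (i : Fin (N + 2)) : Matrix (Fin L) (Fin L) ℂ :=
  evalPoly R (u i) * A i * evalPoly S (u i)

/-- Each `R(z) Aᵢ S(z)` differs from its value at `uᵢ` by a multiple of `z - uᵢ`, so only simple
poles and a polynomial remain. -/
theorem exists_gaugeCoeff_eq (u : Fin (N + 2) → ℂ) (A : Fin (N + 2) → Matrix (Fin L) (Fin L) ℂ)
    (R S : Matrix (Fin L) (Fin L) (Polynomial ℂ)) :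
    ∃ G : Matrix (Fin L) (Fin L) (Polynomial ℂ), ∀ z, (∀ i, z ≠ u i) →
      gaugeCoeff u A R S z = fuchsCoeff u (gaugeResidue u A R S) z + evalPoly G z := by
  have h : ∀ i, ∃ q : Matrix (Fin L) (Fin L) (Polynomial ℂ), ∀ z,
      evalPoly R z * A i * evalPoly S z = gaugeResidue u A R S i + (z - u i) • evalPoly q z := by
    intro i
    set P := R * (A i).map Polynomial.C * S with hP
    have hPz : ∀ z, evalPoly P z = evalPoly R z * A i * evalPoly S z := by
      intro z
      rw [hP, evalPoly_mul, evalPoly_mul]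
      congr 2
      ext a b
      simp [evalPoly]
    have hd := fun a b => Polynomial.X_sub_C_dvd_sub_C_eval (p := P a b) (a := u i)
    choose q hq using hd
    refine ⟨Matrix.of q, fun z => ?_⟩
    rw [gaugeResidue, ← hPz, ← hPz]
    ext a b
    have := congrArg (Polynomial.eval z) (hq a b)
    simp only [Polynomial.eval_sub, Polynomial.eval_C, Polynomial.eval_mul,
      Polynomial.eval_X] at this
    simp only [evalPoly, Matrix.map_apply, Matrix.add_apply, Matrix.smul_apply, smul_eq_mul,
      Matrix.of_apply]
    linear_combination this
  choose q hq using h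
  refine ⟨R.map Polynomial.derivative * S + ∑ i, q i, fun z hz => ?_⟩
  have h1 : evalPoly (R.map Polynomial.derivative * S + ∑ i, q i) z =
      evalPoly (R.map Polynomial.derivative) z * evalPoly S z + ∑ i, evalPoly (q i) z := by
    rw [← evalPoly_mul]
    exact (map_add (Polynomial.evalRingHom z).mapMatrix _ _).trans
      (congrArg _ (map_sum (Polynomial.evalRingHom z).mapMatrix _ _))
  rw [h1, gaugeCoeff, fuchsCoeff, fuchsCoeff, Finset.mul_sum, Finset.sum_mul, add_left_comm,
    ← Finset.sum_add_distrib]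
  congr 1
  refine Finset.sum_congr rfl fun i _ => ?_
  rw [Matrix.mul_smul, Matrix.smul_mul, hq, smul_add, smul_smul,
    inv_mul_cancel₀ (sub_ne_zero.2 (hz i)), one_smul]

theorem analyticAt_fuchsCoeff {z : ℂ} (hz : ∀ i, z ≠ u i) (a b : Fin L) :
    AnalyticAt ℂ (fun z => fuchsCoeff u A z a b) z := by
  simp only [fuchsCoeff, Matrix.sum_apply, Matrix.smul_apply, smul_eq_mul]
  exact Finset.analyticAt_fun_sum _ fun i _ =>
    ((analyticAt_id.sub analyticAt_const).inv (sub_ne_zero.2 (hz i))).mul analyticAt_const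

theorem analyticAt_gaugeCoeff (R S : Matrix (Fin L) (Fin L) (Polynomial ℂ)) {z : ℂ}
    (hz : ∀ i, z ≠ u i) (a b : Fin L) :
    AnalyticAt ℂ (fun z => gaugeCoeff u A R S z a b) z := by
  have hpoly : ∀ P : Matrix (Fin L) (Fin L) (Polynomial ℂ), ∀ i j,
      AnalyticAt ℂ (fun z => evalPoly P z i j) z := fun P i j => analyticAt_eval (P i j) z
  exact (analyticAt_mul_apply (hpoly _) (hpoly _) a b).add (analyticAt_mul_apply
    (analyticAt_mul_apply (hpoly _) (analyticAt_fuchsCoeff hz)) (hpoly _) a b)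

theorem meromorphic_mul_apply {B X : ℂ → Matrix (Fin L) (Fin L) ℂ}
    (hB : ∀ i j, Meromorphic fun z => B z i j) (hX : ∀ i j, Meromorphic fun z => X z i j)
    (i j : Fin L) : Meromorphic fun z => (B z * X z) i j := by
  intro z
  simp only [Matrix.mul_apply]
  exact MeromorphicAt.fun_sum fun k _ => (hB i k z).mul (hX k j z)

theorem meromorphic_gaugeCoeff_inv (R S : Matrix (Fin L) (Fin L) (Polynomial ℂ)) (a b : Fin L) :
    Meromorphic fun w => gaugeCoeff u A R S w⁻¹ a b := by
  have hid : ∀ w, MeromorphicAt (fun w : ℂ => w⁻¹) w := fun w => (MeromorphicAt.id w).inv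
  have hpoly : ∀ P : Matrix (Fin L) (Fin L) (Polynomial ℂ), ∀ i j,
      Meromorphic fun w => evalPoly P w⁻¹ i j := by
    intro P i j w
    simp only [evalPoly, Matrix.map_apply, Polynomial.eval_eq_sum_range]
    exact MeromorphicAt.fun_sum fun k _ => (MeromorphicAt.const _ _).mul ((hid w).pow k)
  have hA : ∀ i j, Meromorphic fun w => fuchsCoeff u A w⁻¹ i j := by
    intro i j w
    simp only [fuchsCoeff, Matrix.sum_apply, Matrix.smul_apply, smul_eq_mul]
    exact MeromorphicAt.fun_sum fun k _ =>
      (((hid w).sub (MeromorphicAt.const _ _)).inv).mul (MeromorphicAt.const _ _)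
  intro w
  exact (meromorphic_mul_apply (hpoly _) (hpoly _) a b w).add
    (meromorphic_mul_apply (meromorphic_mul_apply (hpoly _) hA) (hpoly _) a b w)

theorem hasDerivAt_evalPoly_mul {R S : Matrix (Fin L) (Fin L) (Polynomial ℂ)} (hSR : S * R = 1)
    {Y : ℂ → Matrix (Fin L) (Fin L) ℂ} {z : ℂ}
    (hY : ∀ i j, HasDerivAt (fun x => Y x i j) ((fuchsCoeff u A z * Y z) i j) z) (i j : Fin L) :
    HasDerivAt (fun x => (evalPoly R x * Y x) i j)
      ((gaugeCoeff u A R S z * (evalPoly R z * Y z)) i j) z := by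
  have h1 : gaugeCoeff u A R S z * (evalPoly R z * Y z) =
      evalPoly (R.map Polynomial.derivative) z * Y z +
        evalPoly R z * (fuchsCoeff u A z * Y z) := by
    have h2 : evalPoly S z * (evalPoly R z * Y z) = Y z := by
      rw [← mul_assoc, ← evalPoly_mul, hSR, evalPoly_one, one_mul]
    rw [gaugeCoeff, add_mul, mul_assoc, h2, mul_assoc, mul_assoc, h2]
  rw [h1, Matrix.add_apply]
  simp only [Matrix.mul_apply (M := evalPoly R _),
    Matrix.mul_apply (M := evalPoly (R.map Polynomial.derivative) z)]
  rw [← Finset.sum_add_distrib]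
  exact HasDerivAt.fun_sum fun k _ => ((R i k).hasDerivAt z).mul (hY k j)

/-- If the coefficient of the transformed system is `K / z + o(1 / z)` at infinity, it is
Fuchsian. -/
theorem gaugeCoeff_eq_fuchsCoeff {R S : Matrix (Fin L) (Fin L) (Polynomial ℂ)}
    {K : Matrix (Fin L) (Fin L) ℂ}
    (h : Tendsto (fun w => w⁻¹ • gaugeCoeff u A R S w⁻¹) (𝓝[≠] 0) (𝓝 K)) :
    (∀ z, (∀ i, z ≠ u i) → gaugeCoeff u A R S z = fuchsCoeff u (gaugeResidue u A R S) z) ∧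
      ∑ i, gaugeResidue u A R S i = K := by
  obtain ⟨G, hG⟩ := exists_gaugeCoeff_eq u A R S
  have hne : ∀ᶠ w in 𝓝[≠] (0 : ℂ), w ≠ 0 ∧ ∀ i, w⁻¹ ≠ u i := by
    refine eventually_mem_nhdsWithin.and (eventually_all.2 fun i => ?_)
    have h1 := (tendsto_norm_inv_nhdsNE_zero_atTop (α := ℂ)).eventually_gt_atTop ‖u i‖
    filter_upwards [h1] with w hw heq
    rw [heq] at hw
    exact lt_irrefl _ hw
  have hA := tendsto_smul_fuchsCoeff u (gaugeResidue u A R S)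
  have hid : Tendsto (fun w : ℂ => w) (𝓝[≠] 0) (𝓝 0) := nhdsWithin_le_nhds
  -- Both coefficients have finite limits after multiplication by `z = 1/w`. Their difference is
  -- therefore `w` times something bounded.
  have hlim : Tendsto (fun w => evalPoly G w⁻¹) (𝓝[≠] 0) (𝓝 0) := by
    have h1 := hid.smul (h.sub hA)
    rw [zero_smul] at h1
    refine h1.congr' ?_
    filter_upwards [hne] with w hw
    rw [← smul_sub, smul_smul, mul_inv_cancel₀ hw.1, one_smul, hG _ hw.2, add_sub_cancel_left]
  have hG0 : G = 0 := by
    ext1 a b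
    have h1 := (tendsto_pi_nhds.1 (tendsto_pi_nhds.1 hlim a)) b
    simpa using Polynomial.eq_C_of_tendsto_inv (p := G a b) h1
  have hev : ∀ z, (∀ i, z ≠ u i) →
      gaugeCoeff u A R S z = fuchsCoeff u (gaugeResidue u A R S) z := by
    intro z hz
    rw [hG z hz, hG0]
    ext
    simp [evalPoly]
  refine ⟨hev, tendsto_nhds_unique (hA.congr' ?_) h⟩
  filter_upwards [hne] with w hw
  rw [hev _ hw.2]

/-- The order `b` stays general so that `id` handles the upper triangular residue at `0` and
`OrderDual.toDual` the lower triangular one at infinity. -/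
theorem Matrix.BlockTriangular.mul_mul_of_mul_eq_one {α : Type*} [LinearOrder α]
    {b : Fin L → α} {X D Z : Matrix (Fin L) (Fin L) ℂ} (hX : X.BlockTriangular b)
    (hD : D.BlockTriangular b) (hXZ : X * Z = 1) : (X * D * Z).BlockTriangular b := by
  have : Invertible X := ⟨Z, mul_eq_one_comm.1 hXZ, hXZ⟩
  rw [← Matrix.inv_eq_right_inv hXZ]
  exact (hX.mul hD).mul (Matrix.blockTriangular_inv_of_blockTriangular hX)

theorem Matrix.charpoly_mul_mul_of_mul_eq_one {X D Z : Matrix (Fin L) (Fin L) ℂ}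
    (hZX : Z * X = 1) : (X * D * Z).charpoly = D.charpoly := by
  rw [Matrix.charpoly_mul_comm, ← mul_assoc, hZX, one_mul]

end

/-! ### Transport of the normalization and the exponents to `R Y` -/

theorem exponentShift_eq_intCast (L n : ℕ) (j : Fin L) :
    ∃ m : ℤ, exponentShift L n j = m := by
  rw [exponentShift]
  split_ifs
  · exact ⟨n * (L - 1), by push_cast; ring⟩
  · exact ⟨-n, by push_cast; ring⟩

theorem IsNormalizedSolution.schlesinger {L N n : ℕ} (hL : 0 < L)
    {u : Fin (N + 2) → ℂ} {A : Fin (N + 2) → Matrix (Fin L) (Fin L) ℂ} {ε₀ ε₁ : Fin L → ℂ}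
    (hA : IsFuchsianSystem u A ε₀ ε₁)
    {z₀ a b : RegularPoint u} {γ₀ : Path z₀ a} {γ₁ : Path z₀ b} {l₀ l₁ : ℂ → ℂ}
    {Y : ℂ → Matrix (Fin L) (Fin L) ℂ} {Ψ Φ Φ' : Matrix (Fin L) (Fin L) (PowerSeries ℂ)}
    {C : Matrix (Fin L) (Fin L) ℂ}
    (hY : IsNormalizedSolution u A ε₀ ε₁ γ₀ γ₁ l₀ l₁ Y Ψ Φ C)
    {Q : Fin L → Fin L → Polynomial ℂ} {f : Fin L → PowerSeries ℂ} (hQ : IsHermitePade n f Q)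
    (hΦ' : IsShiftedFactor n Q Φ Φ') {S : Matrix (Fin L) (Fin L) (Polynomial ℂ)}
    (hRS : schlesingerMatrix n Q * S = 1) :
    IsFuchsianSystem u (gaugeResidue u A (schlesingerMatrix n Q) S) ε₀
        (ε₁ + exponentShift L n) ∧
      IsNormalizedSolution u (gaugeResidue u A (schlesingerMatrix n Q) S) ε₀
        (ε₁ + exponentShift L n) γ₀ γ₁ l₀ l₁ (fun z => evalPoly (schlesingerMatrix n Q) z * Y z)
        ((schlesingerMatrix n Q).map (fun p => (p : PowerSeries ℂ)) * Ψ) Φ' C := by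
  set R := schlesingerMatrix n Q with hR
  have hSR : S * R = 1 := mul_eq_one_comm.1 hRS
  have hRSz : ∀ z, evalPoly R z * evalPoly S z = 1 := fun z => by
    rw [← evalPoly_mul, hRS, evalPoly_one]
  have hSRz : ∀ z, evalPoly S z * evalPoly R z = 1 := fun z => by
    rw [← evalPoly_mul, hSR, evalPoly_one]
  have hb : (b : ℂ) ≠ 0 := fun h => b.2 (Fin.last (N + 1)) (h.trans hA.u_last.symm)
  obtain ⟨r, hbr, hΦ⟩ := hY.converges_infty
  obtain ⟨r₀, har, hΨ⟩ := hY.converges_zero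
  have hunit := (hQ.det_schlesingerMatrix_and_isUnit hL hΦ' hY.invertible).2
  have hsolves : ∀ᶠ z in 𝓝 (z₀ : ℂ), ∀ i j, HasDerivAt (fun x => (evalPoly R x * Y x) i j)
      ((gaugeCoeff u A R S z * (evalPoly R z * Y z)) i j) z :=
    hY.solves.mono fun z hz => hasDerivAt_evalPoly_mul hSR hz
  have hinfty : ContinuesTo γ₁ (fun z => evalPoly R z * Y z) fun z =>
      evalSeries Φ' z⁻¹ * diagPow (fun j => -(ε₁ + exponentShift L n) j) l₁ z * C := by
    refine (hY.near_infty.evalPoly_mul R).congr EventuallyEq.rfl ?_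
    have h1 : ∀ᶠ z in 𝓝 (b : ℂ), ‖z⁻¹‖ < r :=
      (continuousAt_inv₀ hb).norm.eventually_lt_const hbr
    filter_upwards [h1, hY.log_infty.2] with z hz hlz
    rw [← mul_assoc, hΦ'.evalPoly_mul_eq hQ hΦ hz hlz]
  -- The system is not yet known to be Fuchsian here. The equation with coefficient `gaugeCoeff` is
  -- continued from `z₀` to `b`, and the local form there supplies the limit at infinity.
  obtain ⟨hcoeff, hres⟩ := gaugeCoeff_eq_fuchsCoeff (tendsto_mul_coeff_at_infty
    (hΦ'.convergesOn hΦ) hb hbr (meromorphic_gaugeCoeff_inv R S) hY.log_infty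
    hY.connection_invertible hunit
    (hinfty.hasDerivAt (fun z hz => analyticAt_gaugeCoeff R S hz) hsolves))
  have hres' : residueInfty (gaugeResidue u A R S) = constTerm Φ' *
      Matrix.diagonal (ε₁ + exponentShift L n) * (constTerm Φ')⁻¹ := by
    rw [residueInfty, hres, neg_neg]
  have hR0 : (evalPoly R 0).BlockTriangular id := fun i j hij => by
    have hij : j < i := hij
    rw [hQ.evalPoly_schlesingerMatrix_zero hij.le, if_neg hij.ne']
  have hlower : ∀ i j, i < j → constTerm Φ' i j = 0 := fun i j => hΦ'.lower hY.lower
  refine ⟨⟨hA.u_first, hA.u_last, hA.u_injective, ?_, ?_, ?_, ?_, hA.nonresonant_zero, ?_⟩,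
    ⟨?_, hY.log_zero, hY.log_infty, ⟨r₀, har, ?_⟩, ⟨r, hbr, hΦ'.convergesOn hΦ⟩, ?_, hlower,
      hunit, hY.connection_invertible, ?_, hinfty⟩⟩
  · intro i j hij
    rw [gaugeResidue, hA.u_last]
    exact Matrix.BlockTriangular.mul_mul_of_mul_eq_one hR0 (fun i j h => hA.upper i j h)
      (hRSz 0) hij
  · intro i j hij
    rw [hres']
    exact Matrix.BlockTriangular.mul_mul_of_mul_eq_one (b := OrderDual.toDual)
      (fun i j h => hlower i j h) (Matrix.blockTriangular_diagonal _)
      (Matrix.mul_nonsing_inv _ hunit) hij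
  · rw [gaugeResidue, Matrix.charpoly_mul_mul_of_mul_eq_one (hSRz _), hA.charpoly_zero]
  · rw [hres', Matrix.charpoly_mul_mul_of_mul_eq_one (Matrix.nonsing_inv_mul _ hunit),
      Matrix.charpoly_diagonal]
  · intro i j hij m h
    obtain ⟨p, hp⟩ := exponentShift_eq_intCast L n i
    obtain ⟨q, hq⟩ := exponentShift_eq_intCast L n j
    refine hA.nonresonant_infty i j hij (m - p + q) ?_
    rw [Pi.add_apply, Pi.add_apply, hp, hq] at h
    push_cast
    linear_combination h
  · have hreg : ∀ᶠ z in 𝓝 (z₀ : ℂ), ∀ i, z ≠ u i :=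
      eventually_all.2 fun i => continuousAt_id.eventually_ne (z₀.2 i)
    filter_upwards [hsolves, hreg] with z hz hz'
    rwa [← hcoeff z hz']
  · intro i k w hw
    simp only [Matrix.mul_apply, Matrix.map_apply, map_sum, Finset.sum_mul]
    exact summable_sum fun j _ => (hasSum_coeff_coe_mul (hΨ j k w hw).hasSum _).summable
  · have h1 : constTerm (R.map (fun p => (p : PowerSeries ℂ)) * Ψ) =
        evalPoly R 0 * constTerm Ψ := by
      refine (map_mul PowerSeries.constantCoeff.mapMatrix _ _).trans ?_
      congr 1
      ext i j
      simp [evalPoly, Polynomial.coeff_zero_eq_eval_zero]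
    intro i j hji
    rw [h1, Matrix.mul_apply]
    -- For `j ≤ i`, the terms `k < i` vanish through `R(0)` and the terms `k > i` through `Ψ(0)`.
    have h2 : ∀ k, evalPoly R 0 i k * constTerm Ψ k j =
        if k = i then (if i = j then 1 else 0) else 0 := by
      intro k
      rcases lt_trichotomy k i with hk | rfl | hk
      · rw [hR0 hk, zero_mul, if_neg hk.ne]
      · rw [hQ.evalPoly_schlesingerMatrix_zero le_rfl, hY.unitriangular k j hji]
        simp
      · have hjk := hji.trans_lt hk
        rw [hY.unitriangular k j hjk.le, if_neg hjk.ne', mul_zero, if_neg hk.ne']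
    simp [h2]
  · refine (hY.near_zero.evalPoly_mul R).congr EventuallyEq.rfl ?_
    have h1 : ∀ᶠ z in 𝓝 (a : ℂ), ‖z‖ < r₀ :=
      continuous_norm.continuousAt.eventually_lt_const har
    filter_upwards [h1] with z hz
    rw [← mul_assoc]
    congr 1
    ext i k
    have h2 : HasSum (fun m : ℕ => PowerSeries.coeff m
        ((R.map (fun p => (p : PowerSeries ℂ)) * Ψ) i k) * z ^ m)
        (∑ j, (R i j).eval z * evalSeries Ψ z j k) := by
      simp only [Matrix.mul_apply, Matrix.map_apply, map_sum, Finset.sum_mul]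
      exact hasSum_sum fun j _ => hasSum_coeff_coe_mul (hΨ j k z hz).hasSum _
    exact h2.tsum_eq.symm

theorem mainTheorem2 (L N n : ℕ) (hL : 2 ≤ L) (hn : 1 ≤ n)
    (u : Fin (N + 2) → ℂ) (A : Fin (N + 2) → Matrix (Fin L) (Fin L) ℂ) (ε₀ ε₁ : Fin L → ℂ)
    (hA : IsFuchsianSystem u A ε₀ ε₁)
    (z₀ a b : RegularPoint u) (γ₀ : Path z₀ a) (γ₁ : Path z₀ b) (l₀ l₁ : ℂ → ℂ)
    (Y : ℂ → Matrix (Fin L) (Fin L) ℂ) (Ψ Φ : Matrix (Fin L) (Fin L) (PowerSeries ℂ))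
    (C : Matrix (Fin L) (Fin L) ℂ)
    (hY : IsNormalizedSolution u A ε₀ ε₁ γ₀ γ₁ l₀ l₁ Y Ψ Φ C)
    (Q : Fin L → Fin L → Polynomial ℂ)
    (hQ : IsHermitePade n (fun i => Φ i ⟨0, by omega⟩) Q) :
    (∃ A' : Fin (N + 2) → Matrix (Fin L) (Fin L) ℂ,
      IsFuchsianSystem u A' ε₀ (ε₁ + exponentShift L n) ∧
      (∀ i, IsConj (A i) (A' i)) ∧
      ∃ Ψ' Φ' : Matrix (Fin L) (Fin L) (PowerSeries ℂ),
        IsNormalizedSolution u A' ε₀ (ε₁ + exponentShift L n) γ₀ γ₁ l₀ l₁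
          (fun z => evalPoly (schlesingerMatrix n Q) z * Y z) Ψ' Φ' C) ∧
    ∀ (γ : Path z₀ z₀) (M : Matrix (Fin L) (Fin L) ℂ),
      IsMonodromyMatrix γ Y M ↔
        IsMonodromyMatrix γ (fun z => evalPoly (schlesingerMatrix n Q) z * Y z) M := by
  have hL0 : 0 < L := by omega
  obtain ⟨Φ', hΦ'⟩ := hQ.exists_isShiftedFactor hL0
  have hdet := (hQ.det_schlesingerMatrix_and_isUnit hL0 hΦ' hY.invertible).1
  set R := schlesingerMatrix n Q
  -- Since `det R = 1`, the adjugate is a polynomial inverse.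
  have hRS : R * R.adjugate = 1 := by rw [Matrix.mul_adjugate, hdet, one_smul]
  have hSR : R.adjugate * R = 1 := by rw [Matrix.adjugate_mul, hdet, one_smul]
  obtain ⟨h1, h2⟩ := hY.schlesinger hL0 hA hQ hΦ' hRS
  refine ⟨⟨_, h1, fun i => ?_, _, _, h2⟩, fun γ M => ⟨fun h => ?_, fun h => ?_⟩⟩
  · refine ⟨⟨evalPoly R (u i), evalPoly R.adjugate (u i), ?_, ?_⟩, ?_⟩
    · rw [← evalPoly_mul, hRS, evalPoly_one]
    · rw [← evalPoly_mul, hSR, evalPoly_one]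
    · change evalPoly R (u i) * A i =
        evalPoly R (u i) * A i * evalPoly R.adjugate (u i) * evalPoly R (u i)
      rw [mul_assoc _ (evalPoly R.adjugate (u i)), ← evalPoly_mul R.adjugate, hSR, evalPoly_one,
        mul_one]
  -- The factor `R` acts on the left and `M` on the right, so associativity alone identifies the
  -- continued germs.
  · have h3 := ContinuesTo.evalPoly_mul h R
    simp only [← mul_assoc] at h3
    exact h3
  · have h3 := ContinuesTo.evalPoly_mul h R.adjugate
    simp only [← mul_assoc, ← evalPoly_mul, hSR, evalPoly_one, one_mul] at h3
    exact h3
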